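/- Let $\mathbb{R}^\infty=\bigsqcup_{n\ge 0}\mathbb{R}^n$ be the set of all finite tuples of real numbers. A BSS machine is a finite program with finitely many real parameters, working on a two-way infinite tape whose cells are blank or hold one real number; it can write a parameter into a cell, add, subtract, multiply and divide the contents of cells, copy or erase the content of a cell, move its head, and fork according to whether a cell is blank or holds a number that is $<0$, $=0$ or $>0$ (a computation that divides by zero or computes with a blank cell gets stuck and does not halt). An oracle BSS machine with oracle $A\subseteq\mathbb{R}^\infty$ can in addition fork according to whether a tuple assembled on its tape (from the head to the first blank cell) lies in $A$. For $B,A\subseteq\mathbb{R}^\infty$ write $B\le_{BSS}A$ if some oracle BSS machine with oracle $A$ computes the characteristic function of $B$ on $\mathbb{R}^\infty$. Let $\mathbb{H}\subseteq\mathbb{R}^\infty$ be the BSS halting problem: the set of all tuples that consist of the code of a BSS machine $P$ (without oracle) followed by an input $\vec{x}\in\mathbb{R}^\infty$ on which $P$ halts, where a program is coded by the number of its instructions followed by a block of five reals for each instruction. For $D\subseteq\mathbb{R}^\infty$ let $\mathbb{Q}(D)\subseteq\mathbb{R}$ denote the subfield generated by all coordinates of all tuples in $D$. **Corollary 3.2.**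 Let $C\subseteq\mathbb{R}^\infty$ be a set such that $\mathbb{H}\le_{BSS}C$. Then $\mathbb{R}$ has finite transcendence degree over $\mathbb{Q}(C)$, and also has finite transcendence degree over the field $\mathbb{Q}(\mathbb{R}^\infty\setminus C)$ generated by the complement of $C$. Moreover, if $C\subseteq\mathbb{R}^m$ for some $m$, then $\mathbb{R}$ also has finite transcendence degree over $\mathbb{Q}(\mathbb{R}^m\setminus C)$. -/

import Mathlib

noncomputable section

namespace BSS

/-- The set `ℝ^∞` of all finite tuples of real numbers. -/
abbrev Tuple : Type := List ℝ

/-- A two-way infinite tape. Each cell is blank (`none`) or holds one real number.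
Cells are addressed relative to the head, which is always at address `0`. In every
configuration reached by a machine only finitely many cells are not blank. -/
abbrev Tape : Type := ℤ → Option ℝ

/-- The four field operations. -/
inductive ArithOp
  | add
  | sub
  | mul
  | div

/-- The value of a field operation; division by zero is undefined. -/
def ArithOp.eval : ArithOp → ℝ → ℝ → Option ℝ
  | .add, a, b => some (a + b)
  | .sub, a, b => some (a - b)
  | .mul, a, b => some (a * b)
  | .div, a, b => open Classical in if b = 0 then none else some (a / b)

/-- The conditions on the content of a cell on which a machine can fork. -/
inductive Test
  | blank
  | zero
  | neg
  | pos

/-- The content of a cell satisfies a test. A blank cell satisfies only the test `blank`. -/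
def Test.Holds : Test → Option ℝ → Prop
  | .blank, o => o = none
  | .zero, o => ∃ a, o = some a ∧ a = 0
  | .neg, o => ∃ a, o = some a ∧ a < 0
  | .pos, o => ∃ a, o = some a ∧ 0 < a

/-- The instructions of a BSS machine.
* `const i c`: write the real parameter `c` into cell `i`;
* `arith op i j k`: write `(cell j) op (cell k)` into cell `i`;
* `copy i j`: copy the content of cell `j` into cell `i`;
* `erase i`: make cell `i` blank;
* `left`, `right`: move the head by one cell;
* `fork t i q`: if the content of cell `i` satisfies `t`, jump to instruction number `q`. -/
inductive Instr
  | const (i : ℤ) (c : ℝ)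
  | arith (op : ArithOp) (i j k : ℤ)
  | copy (i j : ℤ)
  | erase (i : ℤ)
  | left
  | right
  | fork (t : Test) (i : ℤ) (q : ℕ)

/-- The instructions of an oracle BSS machine: those of a BSS machine, and `query q`,
which jumps to instruction number `q` if the tuple on the tape that starts at the head
and ends before the first blank cell belongs to the oracle set. -/
inductive OracleInstr
  | basic (I : Instr)
  | query (q : ℕ)

/-- A BSS machine is given by its program. Its real parameters are the finitely many
numbers `c` of the instructions `const i c`. -/
abbrev Program : Type := List Instr

/-- An oracle BSS machine is given by its program. -/
abbrev OracleProgram : Type := List OracleInstr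

/-- A configuration: the number of the next instruction, and the tape. -/
structure Config where
  pc : ℕ
  tape : Tape

/-- `v` is the tuple that starts at the head and ends before the first blank cell:
cells `0, …, v.length - 1` hold the entries of `v`, and cell `v.length` is blank. -/
def Reads (t : Tape) (v : Tuple) : Prop :=
  ∀ k : ℕ, k ≤ v.length → t (k : ℤ) = v[k]?

/-- The tape with the tuple `x` in cells `0, …, x.length - 1` and all other cells blank. -/
def inputTape (x : Tuple) : Tape :=
  fun k => if 0 ≤ k then x[k.toNat]? else none

/-- The effect of an instruction. There is no next configuration (`none`) after a field
operation on a blank cell or a division by zero. -/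
def Instr.step : Instr → Config → Option Config
  | .const i c, s => some ⟨s.pc + 1, Function.update s.tape i (some c)⟩
  | .arith op i j k, s =>
      (s.tape j).bind fun a => (s.tape k).bind fun b => (op.eval a b).map fun r =>
        ⟨s.pc + 1, Function.update s.tape i (some r)⟩
  | .copy i j, s => some ⟨s.pc + 1, Function.update s.tape i (s.tape j)⟩
  | .erase i, s => some ⟨s.pc + 1, Function.update s.tape i none⟩
  | .left, s => some ⟨s.pc + 1, fun k => s.tape (k - 1)⟩
  | .right, s => some ⟨s.pc + 1, fun k => s.tape (k + 1)⟩
  | .fork t i q, s =>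
      open Classical in some ⟨if t.Holds (s.tape i) then q else s.pc + 1, s.tape⟩

/-- The effect of an instruction of an oracle machine with oracle set `A`. -/
def OracleInstr.step (A : Set Tuple) : OracleInstr → Config → Option Config
  | .basic I, s => I.step s
  | .query q, s =>
      open Classical in some ⟨if ∃ v ∈ A, Reads s.tape v then q else s.pc + 1, s.tape⟩

/-- One step of the machine `M` with oracle `A`. -/
def OracleProgram.step (A : Set Tuple) (M : OracleProgram) (s : Config) : Option Config :=
  M[s.pc]?.bind fun I => I.step A s

/-- The configuration of `M` with oracle `A` on input `x` after `n` steps, if there is one. -/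
def OracleProgram.run (A : Set Tuple) (M : OracleProgram) (x : Tuple) : ℕ → Option Config
  | 0 => some ⟨0, inputTape x⟩
  | n + 1 => (OracleProgram.run A M x n).bind (OracleProgram.step A M)

/-- `M` with oracle `A` on input `x` reaches the final configuration `s`. A machine halts when
the number of the next instruction is not the number of an instruction of the program;
a computation that gets stuck at an undefined field operation does not halt. -/
def OracleProgram.HaltsAt (A : Set Tuple) (M : OracleProgram) (x : Tuple) (s : Config) : Prop :=
  (∃ n, OracleProgram.run A M x n = some s) ∧ M[s.pc]? = none

/-- `M` with oracle `A` halts on input `x` with output `v`. -/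
def OracleProgram.Outputs (A : Set Tuple) (M : OracleProgram) (x v : Tuple) : Prop :=
  ∃ s, OracleProgram.HaltsAt A M x s ∧ Reads s.tape v

/-- The BSS machine `P` halts on input `x`: it is run as an oracle machine that asks
no queries, so the oracle is irrelevant. -/
def Program.Halts (P : Program) (x : Tuple) : Prop :=
  ∃ s, OracleProgram.HaltsAt ∅ (P.map OracleInstr.basic) x s

/-- `B ≤_BSS A`: some oracle BSS machine with oracle `A` computes the characteristic
function of `B`. -/
def Reducible (B A : Set Tuple) : Prop :=
  ∃ M : OracleProgram, ∀ x : Tuple,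
    OracleProgram.Outputs A M x [Set.indicator B (fun _ => (1 : ℝ)) x]

/-- The number of a field operation. -/
def ArithOp.code : ArithOp → ℝ
  | .add => 0
  | .sub => 1
  | .mul => 2
  | .div => 3

/-- The number of a test. -/
def Test.code : Test → ℝ
  | .blank => 0
  | .zero => 1
  | .neg => 2
  | .pos => 3

/-- The code of an instruction, a block of five real numbers. -/
def Instr.code : Instr → Tuple
  | .const i c => [0, (i : ℝ), c, 0, 0]
  | .arith op i j k => [1, op.code, (i : ℝ), (j : ℝ), (k : ℝ)]
  | .copy i j => [2, (i : ℝ), (j : ℝ), 0, 0]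
  | .erase i => [3, (i : ℝ), 0, 0, 0]
  | .left => [4, 0, 0, 0, 0]
  | .right => [5, 0, 0, 0, 0]
  | .fork t i q => [6, t.code, (i : ℝ), (q : ℝ), 0]

/-- The code of a BSS machine: the number of its instructions, and then their codes.
This is a self-delimiting code: a machine and an input can be recovered from
the concatenation of the code of the machine with the input. -/
def Program.code (P : Program) : Tuple :=
  (P.length : ℝ) :: P.flatMap Instr.code

/-- The halting problem for BSS machines: all tuples that consist of the code of a
BSS machine followed by an input on which this machine halts. -/
def haltingProblem : Set Tuple :=
  {w | ∃ (P : Program) (x : Tuple), w = Program.code P ++ x ∧ Program.Halts P x}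

/-- The subfield of `ℝ` generated by the coordinates of the tuples in `C`. -/
def coordField (C : Set Tuple) : Subfield ℝ :=
  Subfield.closure {r | ∃ v ∈ C, r ∈ v}

end BSS

end

/-! Suppose `M` decides the halting problem with oracle `C`, and `ℝ` has infinite transcendence
degree over `K`, one of the three coordinate fields. All that matters about `C` is that membership
of a tuple with an entry outside `K` depends on its length alone (`DeterminedOutside`). Let `F` be
`K` with the parameters of `M` adjoined, `y` transcendental over `F`, `L = F(y)`, and `x₀`
transcendental over `L`, with `x₀` and `y` in `[-2, 2]`. Whether `y` lies in the forward orbit of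
`x₀` under `a ↦ a² - 2` is an instance of the halting problem (`orbitProgram`), and the answer is
no. But there are `z n → x₀` whose `n`-th iterate is `y` (`exists_sqSubTwo_iterate_eq`), where the
answer is yes.

For large `n` the machine cannot tell `z n` from `x₀`. After a fixed number of steps the cells hold
rational functions of the input over `L` (`OracleProgram.run_uniform`), whose signs at `x₀` persist
nearby. As for queries, `z n` has degree at least `2 ^ n` over `L`
(`natDegree_le_of_aeval_eq_zero`), so a rational function with a value in `F` at `z n`, for large
`n`, is constant. Hence each entry of a query is eventually constant or eventually outside `F ⊇ K`,
and the answer stabilizes (`query_uniform`). The contradiction is drawn in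
`not_computes_of_frequently`. -/

namespace BSS

open Polynomial Filter Topology
open scoped IntermediateField
-- Degrees over a simple transcendental extension
section Degree

variable {F A : Type*} [Field F] [Field A] [Algebra F A]

/-- If `t` is transcendental over `F`, then the degree of `t` over `F(q(t))` is at least the
degree of the polynomial `q`. -/
theorem natDegree_le_of_aeval_eq_zero {t : A} (ht : Transcendental F t) (q : F[X]) {y : A}
    (hy : aeval t q = y) {p : F⟮y⟯[X]} (hp : p ≠ 0) (hpt : aeval t p = 0) :
    q.natDegree ≤ p.natDegree := by
  by_cases hq : q.natDegree = 0
  · omega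
  -- As `t` behaves like a variable, `p` can be pulled back along `φ` to `F(X)`, where the degree of
  -- `X` over `F(f)` is known.
  let φ : RatFunc F →ₐ[F] A :=
    (IntermediateField.val _).comp (RatFunc.algEquivOfTranscendental t ht).toAlgHom
  let f : RatFunc F := algebraMap F[X] (RatFunc F) q
  have hφX : φ RatFunc.X = t := by simp [φ]
  have hφf : φ f = y := by
    simp [φ, f, ← hy]
  have hf : ¬ ∃ c, f = RatFunc.C c := by
    rintro ⟨c, hc⟩
    rw [← RatFunc.algebraMap_C] at hc
    have := RatFunc.algebraMap_injective F hc
    exact hq (by rw [this, natDegree_C])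
  have hmap : F⟮f⟯.map φ = F⟮y⟯ := by
    rw [IntermediateField.adjoin_map, Set.image_singleton, hφf]
  have hlift : p ∈ Polynomial.lifts
      ((IntermediateField.inclusion hmap.le).comp
        (F⟮f⟯.equivMap φ).toAlgHom : F⟮f⟯ →ₐ[F] F⟮y⟯).toRingHom := by
    rw [Polynomial.lifts_iff_coeff_lifts]
    intro n
    obtain ⟨c, hc, hce⟩ := hmap.ge (p.coeff n).2
    exact ⟨⟨c, hc⟩, Subtype.ext hce⟩
  obtain ⟨p', hp'⟩ := hlift
  have hroot : aeval (RatFunc.X : RatFunc F) p' = 0 := by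
    apply φ.toRingHom.injective
    rw [map_zero, ← hpt, ← hp']
    simp only [aeval_def, coe_mapRingHom, eval₂_map, hom_eval₂]
    congr 1
  have hp'0 : p' ≠ 0 := by
    rintro rfl
    exact hp (by rw [← hp', map_zero])
  have hdvd : f.minpolyX F⟮f⟯ ∣ p' := by
    have h := minpoly.dvd F⟮f⟯ _ hroot
    rw [← minpoly.eq_of_irreducible (f.irreducible_minpolyX hf) f.minpolyX_aeval_X] at h
    exact (dvd_mul_right _ _).trans h
  have h1 := f.natDegree_minpolyX.symm.le.trans (natDegree_le_of_dvd hdvd hp'0)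
  have h2 : p.natDegree = p'.natDegree := by
    rw [← hp']
    exact natDegree_map _
  have h3 : q.natDegree ≤ f.num.natDegree := by simp [f]
  omega

end Degree

/-! ### Germs of rational functions along a filter -/

/-- Along `l`, the degree over `L` tends to infinity. -/
def EventuallyGeneric (L : Type*) [Field L] [Algebra L ℝ] (l : Filter ℝ) : Prop :=
  ∀ N : ℕ, ∀ᶠ x in l, ∀ p : L[X], p ≠ 0 → p.natDegree ≤ N → aeval x p ≠ 0

/-- Along `l`, the function `u` is a rational function with coefficients in `L`. -/
def RationalGerm (L : Type*) [Field L] [Algebra L ℝ] (l : Filter ℝ) (u : ℝ → ℝ) : Prop :=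
  ∃ g h : L[X], h ≠ 0 ∧ ∀ᶠ x in l, u x = aeval x g / aeval x h

section Germ

variable {L : Type*} [Field L] [Algebra L ℝ] {l : Filter ℝ}

theorem EventuallyGeneric.aeval_ne_zero (hl : EventuallyGeneric L l) {p : L[X]} (hp : p ≠ 0) :
    ∀ᶠ x in l, aeval x p ≠ 0 :=
  (hl p.natDegree).mono fun _ hx => hx p hp le_rfl

theorem RationalGerm.const (c : L) : RationalGerm L l fun _ => algebraMap L ℝ c :=
  ⟨C c, 1, one_ne_zero, by simp⟩

theorem RationalGerm.id : RationalGerm L l fun x => x :=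
  ⟨X, 1, one_ne_zero, by simp⟩

theorem RationalGerm.add (hl : EventuallyGeneric L l) {u v : ℝ → ℝ} (hu : RationalGerm L l u)
    (hv : RationalGerm L l v) : RationalGerm L l fun x => u x + v x := by
  obtain ⟨g, h, h0, hu⟩ := hu
  obtain ⟨g', h', h0', hv⟩ := hv
  refine ⟨g * h' + h * g', h * h', mul_ne_zero h0 h0', ?_⟩
  filter_upwards [hu, hv, hl.aeval_ne_zero h0, hl.aeval_ne_zero h0'] with x h1 h2 h3 h4
  rw [h1, h2, div_add_div _ _ h3 h4]
  simp

theorem RationalGerm.mul {u v : ℝ → ℝ} (hu : RationalGerm L l u)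
    (hv : RationalGerm L l v) : RationalGerm L l fun x => u x * v x := by
  obtain ⟨g, h, h0, hu⟩ := hu
  obtain ⟨g', h', h0', hv⟩ := hv
  refine ⟨g * g', h * h', mul_ne_zero h0 h0', ?_⟩
  filter_upwards [hu, hv] with x h1 h2
  rw [h1, h2, div_mul_div_comm]
  simp

theorem RationalGerm.sub (hl : EventuallyGeneric L l) {u v : ℝ → ℝ} (hu : RationalGerm L l u)
    (hv : RationalGerm L l v) : RationalGerm L l fun x => u x - v x := by
  have := hu.add hl ((RationalGerm.const (l := l) (-1 : L)).mul hv)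
  simpa [sub_eq_add_neg] using this

theorem RationalGerm.inv {u : ℝ → ℝ} (hu : RationalGerm L l u) :
    RationalGerm L l fun x => (u x)⁻¹ := by
  obtain ⟨g, h, h0, hu⟩ := hu
  by_cases hg : g = 0
  · refine ⟨0, 1, one_ne_zero, hu.mono fun x hx => ?_⟩
    simp [hx, hg]
  · exact ⟨h, g, hg, hu.mono fun x hx => by simp [hx]⟩

theorem RationalGerm.div {u v : ℝ → ℝ} (hu : RationalGerm L l u)
    (hv : RationalGerm L l v) : RationalGerm L l fun x => u x / v x := by
  simpa only [div_eq_mul_inv] using hu.mul hv.inv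

/-- The sign of a rational function with coefficients in `L` is constant along a filter that
converges to a number transcendental over `L`. -/
theorem RationalGerm.sign {x₀ : ℝ} (hx₀ : Transcendental L x₀) (hl : l ≤ 𝓝 x₀) {u : ℝ → ℝ}
    (hu : RationalGerm L l u) :
    (∀ᶠ x in l, u x = 0) ∨ (∀ᶠ x in l, u x < 0) ∨ (∀ᶠ x in l, 0 < u x) := by
  obtain ⟨g, h, h0, hu⟩ := hu
  by_cases hg : g = 0
  · exact Or.inl (hu.mono fun x hx => by simp [hx, hg])
  -- Neither numerator nor denominator vanishes at `x₀`, so the quotient is continuous and nonzero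
  -- there and keeps its sign nearby.
  have hne : ∀ p : L[X], p ≠ 0 → aeval x₀ p ≠ 0 := fun p hp h => hx₀ ⟨p, hp, h⟩
  have hc : ContinuousAt (fun x : ℝ => aeval x g / aeval x h) x₀ :=
    (Polynomial.continuous_aeval g).continuousAt.div
      (Polynomial.continuous_aeval h).continuousAt (hne h h0)
  rcases (div_ne_zero (hne g hg) (hne h h0)).lt_or_gt with hs | hs
  · refine Or.inr (Or.inl ?_)
    filter_upwards [hu, hl (hc.eventually (gt_mem_nhds hs))] with x h1 h2
    rw [h1]; exact h2
  · refine Or.inr (Or.inr ?_)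
    filter_upwards [hu, hl (hc.eventually (lt_mem_nhds hs))] with x h1 h2
    rw [h1]; exact h2

/-- Either a rational function is eventually a constant of the base field, or its values
eventually lie outside the base field. -/
theorem RationalGerm.const_or_notMem {F : Type*} [Field F] [Algebra F ℝ] [Algebra F L]
    [IsScalarTower F L ℝ] (hl : EventuallyGeneric L l) {u : ℝ → ℝ} (hu : RationalGerm L l u) :
    (∃ c : ℝ, ∀ᶠ x in l, u x = c) ∨
      ∀ᶠ x in l, u x ∉ (algebraMap F ℝ).range := by
  obtain ⟨g, h, h0, hu⟩ := hu
  by_cases hc : ∃ c : F, g = C (algebraMap F L c) * h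
  · obtain ⟨c, rfl⟩ := hc
    refine Or.inl ⟨algebraMap F ℝ c, ?_⟩
    filter_upwards [hu, hl.aeval_ne_zero h0] with x h1 h2
    rw [h1, map_mul, aeval_C, ← IsScalarTower.algebraMap_apply, mul_div_cancel_right₀ _ h2]
  · push Not at hc
    refine Or.inr ?_
    -- The degree of `g - c h` is bounded independently of `c`, so a single such `x` excludes all
    -- `c` in `F` at once.
    filter_upwards [hu, hl.aeval_ne_zero h0, hl (max g.natDegree h.natDegree)] with x h1 h2 h3
    rintro ⟨c, hcx⟩
    refine h3 (g - C (algebraMap F L c) * h) (sub_ne_zero.2 (hc c)) ?_ ?_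
    · exact (natDegree_sub_le _ _).trans (max_le_max le_rfl (natDegree_C_mul_le _ _))
    · rw [h1, eq_div_iff h2] at hcx
      rw [map_sub, map_mul, aeval_C, ← IsScalarTower.algebraMap_apply, hcx, sub_self]

end Germ

/-! ### Computations on germs -/

section Machine

/-- Membership in `C` of a tuple with an entry outside `E` depends only on the length of the
tuple. -/
def DeterminedOutside (E : Set ℝ) (C : Set Tuple) : Prop :=
  ∀ n : ℕ, ∃ b : Prop, ∀ v : Tuple, v.length = n → (∃ r ∈ v, r ∉ E) → (v ∈ C ↔ b)

/-- A tape whose cells hold functions of a real number. -/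
abbrev FunTape : Type := ℤ → Option (ℝ → ℝ)

/-- The tape obtained by evaluating the content of all cells at `x`. -/
def FunTape.eval (τ : FunTape) (x : ℝ) : Tape := fun k => (τ k).map fun u => u x

theorem FunTape.eval_update (τ : FunTape) (i : ℤ) (o : Option (ℝ → ℝ)) (x : ℝ) :
    FunTape.eval (Function.update τ i o) x =
      Function.update (τ.eval x) i (o.map fun u => u x) := by
  funext k
  by_cases h : k = i
  · subst h; simp [FunTape.eval]
  · simp [FunTape.eval, h]

/-- All cells of the tape hold rational functions. -/
def FunTape.IsRational (L : Type*) [Field L] [Algebra L ℝ] (l : Filter ℝ) (τ : FunTape) : Prop :=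
  ∀ k u, τ k = some u → RationalGerm L l u

variable {L : Type*} [Field L] [Algebra L ℝ] {l : Filter ℝ}

theorem FunTape.IsRational.update {τ : FunTape} (hτ : τ.IsRational L l) (i : ℤ)
    {o : Option (ℝ → ℝ)} (ho : ∀ u, o = some u → RationalGerm L l u) :
    FunTape.IsRational L l (Function.update τ i o) := by
  intro k u h
  by_cases hk : k = i
  · subst hk
    exact ho u (by simpa using h)
  · exact hτ k u (by simpa [hk] using h)

/-- Along `l`, the configurations `s x` are all undefined, or have the same instruction number
and rational functions of `x` on the tape. -/
def Uniform (L : Type*) [Field L] [Algebra L ℝ] (l : Filter ℝ) (s : ℝ → Option Config) : Prop :=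
  (∀ᶠ x in l, s x = none) ∨
    ∃ (pc : ℕ) (τ : FunTape), τ.IsRational L l ∧ ∀ᶠ x in l, s x = some ⟨pc, τ.eval x⟩

/-- The value of an arithmetic operation is eventually undefined or a rational function. -/
theorem ArithOp.eval_uniform {x₀ : ℝ} (hx₀ : Transcendental L x₀) (hl₀ : l ≤ 𝓝 x₀)
    (hl : EventuallyGeneric L l) (op : ArithOp) {u v : ℝ → ℝ} (hu : RationalGerm L l u)
    (hv : RationalGerm L l v) :
    (∀ᶠ x in l, op.eval (u x) (v x) = none) ∨
      ∃ w, RationalGerm L l w ∧ ∀ᶠ x in l, op.eval (u x) (v x) = some (w x) := by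
  cases op with
  | add => exact Or.inr ⟨_, hu.add hl hv, by simp [ArithOp.eval]⟩
  | sub => exact Or.inr ⟨_, hu.sub hl hv, by simp [ArithOp.eval]⟩
  | mul => exact Or.inr ⟨_, hu.mul hv, by simp [ArithOp.eval]⟩
  | div =>
    rcases hv.sign hx₀ hl₀ with h | h | h
    · exact Or.inl (h.mono fun x hx => by simp [ArithOp.eval, hx])
    · exact Or.inr ⟨_, hu.div hv, h.mono fun x hx => by simp [ArithOp.eval, hx.ne]⟩
    · exact Or.inr ⟨_, hu.div hv, h.mono fun x hx => by simp [ArithOp.eval, hx.ne']⟩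

theorem Test.holds_uniform {x₀ : ℝ} (hx₀ : Transcendental L x₀) (hl₀ : l ≤ 𝓝 x₀)
    (t : Test) {τ : FunTape} (hτ : τ.IsRational L l) (i : ℤ) :
    (∀ᶠ x in l, t.Holds (τ.eval x i)) ∨ (∀ᶠ x in l, ¬ t.Holds (τ.eval x i)) := by
  cases hi : τ i with
  | none => cases t <;> simp [Test.Holds, FunTape.eval, hi]
  | some u =>
    have hs := (hτ i u hi).sign hx₀ hl₀
    cases t with
    | blank => simp [Test.Holds, FunTape.eval, hi]
    | zero =>
      simp only [Test.Holds, FunTape.eval, hi, Option.map_some, Option.some.injEq,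
        exists_eq_left']
      rcases hs with h | h | h
      · exact Or.inl h
      · exact Or.inr (h.mono fun x hx => hx.ne)
      · exact Or.inr (h.mono fun x hx => hx.ne')
    | neg =>
      simp only [Test.Holds, FunTape.eval, hi, Option.map_some, Option.some.injEq,
        exists_eq_left']
      rcases hs with h | h | h
      · exact Or.inr (h.mono fun x hx => hx.not_lt)
      · exact Or.inl h
      · exact Or.inr (h.mono fun x hx => hx.not_gt)
    | pos =>
      simp only [Test.Holds, FunTape.eval, hi, Option.map_some, Option.some.injEq,
        exists_eq_left']
      rcases hs with h | h | h
      · exact Or.inr (h.mono fun x hx => hx.not_gt)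
      · exact Or.inr (h.mono fun x hx => hx.not_gt)
      · exact Or.inl h

theorem FunTape.reads_eval_iff {τ : FunTape} {n : ℕ} {us : ℕ → ℝ → ℝ} (hn : τ n = none)
    (hus : ∀ k < n, τ k = some (us k)) (x : ℝ) (v : Tuple) :
    Reads (τ.eval x) v ↔ v = List.ofFn fun k : Fin n => us k x := by
  constructor
  · intro h
    have hlen : v.length = n := by
      rcases lt_trichotomy v.length n with hlt | heq | hgt
      · have := h v.length le_rfl
        simp [FunTape.eval, hus _ hlt] at this
      · exact heq
      · have := h n hgt.le
        simp [FunTape.eval, hn, hgt] at this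
    refine List.ext_getElem (by simp [hlen]) fun k h1 h2 => ?_
    have := h k h1.le
    rw [List.getElem?_eq_getElem h1] at this
    simpa [FunTape.eval, hus k (hlen ▸ h1)] using this.symm
  · rintro rfl k hk
    rw [List.length_ofFn] at hk
    rcases hk.lt_or_eq with hk | rfl
    · simp [FunTape.eval, hus k hk, hk]
    · simp [FunTape.eval, hn]

/-- Either some entry before the first blank cell is eventually outside `F`, and the length decides
the answer, or all entries are eventually constant and the same tuple is always queried. If no cell
to the right is blank, no tuple is read. -/
theorem query_uniform {F : Type*} [Field F] [Algebra F ℝ] [Algebra F L] [IsScalarTower F L ℝ]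
    (hl : EventuallyGeneric L l) {C : Set Tuple}
    (hC : DeterminedOutside (algebraMap F ℝ).range C) {τ : FunTape} (hτ : τ.IsRational L l) :
    (∀ᶠ x in l, ∃ v ∈ C, Reads (τ.eval x) v) ∨ (∀ᶠ x in l, ¬ ∃ v ∈ C, Reads (τ.eval x) v) := by
  classical
  by_cases hb : ∃ n : ℕ, τ n = none
  · obtain ⟨n, hn, hmin⟩ : ∃ n : ℕ, τ n = none ∧ ∀ k < n, τ k ≠ none :=
      ⟨Nat.find hb, Nat.find_spec hb, fun k hk => Nat.find_min hb hk⟩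
    have hex : ∀ k : ℕ, ∃ u : ℝ → ℝ, k < n → τ k = some u := by
      intro k
      by_cases hk : k < n
      · obtain ⟨u, hu⟩ := Option.ne_none_iff_exists'.1 (hmin k hk)
        exact ⟨u, fun _ => hu⟩
      · exact ⟨0, fun h => absurd h hk⟩
    choose us hus using hex
    simp only [FunTape.reads_eval_iff hn hus, exists_eq_right]
    by_cases hout : ∃ k < n, ∀ᶠ x in l, us k x ∉ (algebraMap F ℝ).range
    · obtain ⟨k, hk, hout⟩ := hout
      obtain ⟨b, hb⟩ := hC n
      have key : ∀ᶠ x in l, (List.ofFn fun k : Fin n => us k x) ∈ C ↔ b :=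
        hout.mono fun x hx => hb _ (by simp) ⟨us k x, by
          rw [List.mem_ofFn]; exact ⟨⟨k, hk⟩, rfl⟩, hx⟩
      by_cases hb' : b
      · exact Or.inl (key.mono fun x hx => hx.2 hb')
      · exact Or.inr (key.mono fun x hx h => hb' (hx.1 h))
    · push Not at hout
      have hconst : ∀ k : Fin n, ∃ c : ℝ, ∀ᶠ x in l, us k x = c := fun k =>
        ((hτ k (us k) (hus k k.2)).const_or_notMem (F := F) hl).resolve_right
          fun h => hout k k.2 h
      choose c hc using hconst
      have key : ∀ᶠ x in l, (List.ofFn fun k : Fin n => us k x) = List.ofFn c :=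
        (eventually_all.2 hc).mono fun x hx => by
          congr 1
          funext k
          exact hx k
      by_cases hb' : List.ofFn c ∈ C
      · exact Or.inl (key.mono fun x hx => hx ▸ hb')
      · exact Or.inr (key.mono fun x hx => hx ▸ hb')
  · refine Or.inr (Eventually.of_forall ?_)
    rintro x ⟨v, -, hv⟩
    have := hv v.length le_rfl
    simp only [FunTape.eval, List.getElem?_length, Option.map_eq_none_iff] at this
    exact hb ⟨_, this⟩

theorem Uniform.fork {p : ℝ → Prop} [∀ x, Decidable (p x)]
    (hp : (∀ᶠ x in l, p x) ∨ (∀ᶠ x in l, ¬ p x)) {τ : FunTape} (hτ : τ.IsRational L l)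
    (q r : ℕ) : Uniform L l fun x => some ⟨if p x then q else r, τ.eval x⟩ := by
  rcases hp with h | h
  · exact Or.inr ⟨q, τ, hτ, h.mono fun x hx => by simp only [if_pos hx]⟩
  · exact Or.inr ⟨r, τ, hτ, h.mono fun x hx => by simp only [if_neg hx]⟩

theorem Instr.step_uniform {x₀ : ℝ} (hx₀ : Transcendental L x₀) (hl₀ : l ≤ 𝓝 x₀)
    (hl : EventuallyGeneric L l) (I : Instr)
    (hI : ∀ i c, I = .const i c → c ∈ (algebraMap L ℝ).range)
    (pc : ℕ) {τ : FunTape} (hτ : τ.IsRational L l) :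
    Uniform L l fun x => I.step ⟨pc, τ.eval x⟩ := by
  cases I with
  | const i c =>
    obtain ⟨d, rfl⟩ := hI i c rfl
    refine Or.inr ⟨pc + 1, Function.update τ i (some fun _ => algebraMap L ℝ d),
      hτ.update i ?_, ?_⟩
    · rintro u ⟨rfl⟩
      exact RationalGerm.const d
    · simp [Instr.step, FunTape.eval_update]
  | arith op i j k =>
    cases hj : τ j with
    | none => exact Or.inl (Eventually.of_forall fun x => by simp [Instr.step, FunTape.eval, hj])
    | some u =>
      cases hk : τ k with
      | none =>
        exact Or.inl (Eventually.of_forall fun x => by simp [Instr.step, FunTape.eval, hj, hk])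
      | some v =>
        rcases op.eval_uniform hx₀ hl₀ hl (hτ j u hj) (hτ k v hk) with h | ⟨w, hw, h⟩
        · exact Or.inl (h.mono fun x hx => by simp [Instr.step, FunTape.eval, hj, hk, hx])
        · refine Or.inr ⟨pc + 1, Function.update τ i (some w), hτ.update i ?_, ?_⟩
          · rintro u ⟨rfl⟩
            exact hw
          · refine h.mono fun x hx => ?_
            rw [FunTape.eval_update]
            simp [Instr.step, FunTape.eval, hj, hk, hx]
  | copy i j =>
    refine Or.inr ⟨pc + 1, Function.update τ i (τ j), hτ.update i (hτ j), ?_⟩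
    refine Eventually.of_forall fun x => ?_
    rw [FunTape.eval_update]
    rfl
  | erase i =>
    refine Or.inr ⟨pc + 1, Function.update τ i none, hτ.update i (by simp), ?_⟩
    refine Eventually.of_forall fun x => ?_
    rw [FunTape.eval_update]
    rfl
  | left =>
    exact Or.inr ⟨pc + 1, fun k => τ (k - 1), fun k => hτ (k - 1), Eventually.of_forall
      fun x => rfl⟩
  | right =>
    exact Or.inr ⟨pc + 1, fun k => τ (k + 1), fun k => hτ (k + 1), Eventually.of_forall
      fun x => rfl⟩
  | fork t i q =>
    classical
    exact Uniform.fork (t.holds_uniform hx₀ hl₀ hτ i) hτ q (pc + 1)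

/-- If the entries of the inputs are rational functions along `l`, then so are the contents of
the cells after `n` steps, and the path of the computation is eventually constant. -/
theorem OracleProgram.run_uniform {F : Type*} [Field F] [Algebra F ℝ] [Algebra F L]
    [IsScalarTower F L ℝ] {x₀ : ℝ} (hx₀ : Transcendental L x₀) (hl₀ : l ≤ 𝓝 x₀)
    (hl : EventuallyGeneric L l) {C : Set Tuple}
    (hC : DeterminedOutside (algebraMap F ℝ).range C) {M : OracleProgram}
    (hM : ∀ i c, .basic (.const i c) ∈ M → c ∈ (algebraMap L ℝ).range)
    {us : List (ℝ → ℝ)} (hus : ∀ u ∈ us, RationalGerm L l u) (n : ℕ) :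
    Uniform L l fun x => M.run C (us.map fun u => u x) n := by
  induction n with
  | zero =>
    refine Or.inr ⟨0, fun k => if 0 ≤ k then us[k.toNat]? else none, ?_, ?_⟩
    · intro k u h
      dsimp only at h
      split_ifs at h
      exact hus u (List.mem_of_getElem? h)
    · refine Eventually.of_forall fun x => ?_
      simp only [OracleProgram.run, Option.some.injEq, Config.mk.injEq, true_and]
      funext k
      simp only [inputTape, FunTape.eval]
      split_ifs <;> simp
  | succ n ih =>
    rcases ih with h | ⟨pc, τ, hτ, h⟩
    · exact Or.inl (h.mono fun x hx => by simp [OracleProgram.run, hx])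
    have hstep : Uniform L l fun x => M.step C ⟨pc, τ.eval x⟩ := by
      cases hI : M[pc]? with
      | none => exact Or.inl (Eventually.of_forall fun x => by simp [OracleProgram.step, hI])
      | some I =>
        simp only [OracleProgram.step, hI, Option.bind_some]
        cases I with
        | basic I =>
          refine I.step_uniform hx₀ hl₀ hl ?_ pc hτ
          rintro i c rfl
          exact hM i c (List.mem_of_getElem? hI)
        | query q =>
          classical
          exact Uniform.fork (query_uniform hl hC hτ) hτ q (pc + 1)
    rcases hstep with h' | ⟨pc', τ', hτ', h'⟩
    · exact Or.inl ((h.and h').mono fun x hx => by simp [OracleProgram.run, hx.1, hx.2])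
    · exact Or.inr ⟨pc', τ', hτ',
        (h.and h').mono fun x hx => by simp [OracleProgram.run, hx.1, hx.2]⟩

end Machine

/-! ### Final configurations and indistinguishable inputs -/

theorem OracleProgram.run_add {A : Set Tuple} {M : OracleProgram} {x : Tuple} {n : ℕ} {s : Config}
    (h : M.run A x n = some s) (hs : M[s.pc]? = none) (k : ℕ) : M.run A x (n + k + 1) = none := by
  induction k with
  | zero => simp [OracleProgram.run, h, OracleProgram.step, hs]
  | succ k ih =>
    rw [← add_assoc, OracleProgram.run, ih]
    rfl

theorem OracleProgram.HaltsAt.unique {A : Set Tuple} {M : OracleProgram} {x : Tuple}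
    {s s' : Config} (h : M.HaltsAt A x s) (h' : M.HaltsAt A x s') : s = s' := by
  obtain ⟨⟨n, hn⟩, hs⟩ := h
  obtain ⟨⟨m, hm⟩, hs'⟩ := h'
  rcases lt_trichotomy n m with hlt | rfl | hgt
  · obtain ⟨k, rfl⟩ := Nat.exists_eq_add_of_lt hlt
    rw [run_add hn hs k] at hm
    cases hm
  · exact Option.some.inj (hn.symm.trans hm)
  · obtain ⟨k, rfl⟩ := Nat.exists_eq_add_of_lt hgt
    rw [run_add hm hs' k] at hn
    cases hn

/-- A machine that decides `B` with an oracle determined outside `F` cannot distinguish `x₀` from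
nearby numbers of large degree. -/
theorem not_computes_of_frequently {F L : Type*} [Field F] [Field L] [Algebra F ℝ] [Algebra F L]
    [Algebra L ℝ] [IsScalarTower F L ℝ] {x₀ : ℝ} (hx₀ : Transcendental L x₀) {l : Filter ℝ}
    (hl₀ : l ≤ 𝓝 x₀) (hl : EventuallyGeneric L l) [l.NeBot] {C B : Set Tuple}
    (hC : DeterminedOutside (algebraMap F ℝ).range C) {M : OracleProgram}
    (hM : ∀ i c, .basic (.const i c) ∈ M → c ∈ (algebraMap L ℝ).range)
    {us : List (ℝ → ℝ)} (hus : ∀ u ∈ us, ∀ l', RationalGerm L l' u)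
    (h0 : (us.map fun u => u x₀) ∉ B) (h1 : ∀ᶠ x in l, (us.map fun u => u x) ∈ B) :
    ¬ ∀ w : Tuple, M.Outputs C w [Set.indicator B (fun _ => (1 : ℝ)) w] := by
  intro hcomp
  -- Adding the point `x₀` to the filter lets one computation path serve `x₀` and its approximants
  -- together.
  have hl' : EventuallyGeneric L (pure x₀ ⊔ l) := fun N =>
    eventually_sup.2 ⟨eventually_pure.2 fun p hp _ h => hx₀ ⟨p, hp, h⟩, hl N⟩
  have hl₀' : pure x₀ ⊔ l ≤ 𝓝 x₀ := sup_le (pure_le_nhds x₀) hl₀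
  obtain ⟨s, ⟨⟨n, hn⟩, hs⟩, hr⟩ := hcomp (us.map fun u => u x₀)
  rw [Set.indicator_of_notMem h0] at hr
  rcases M.run_uniform hx₀ hl₀' hl' hC hM (fun u hu => hus u hu _) n with h | ⟨pc, τ, hτ, h⟩
  · have := eventually_pure.1 (eventually_sup.1 h).1
    simp only [hn, reduceCtorEq] at this
  · obtain ⟨hx, hy⟩ := eventually_sup.1 h
    have hx := eventually_pure.1 hx
    simp only [hn, Option.some.injEq] at hx
    subst hx
    have hcell := hr 0 (by simp)
    simp only [Nat.cast_zero, FunTape.eval, List.length_singleton, Nat.lt_add_one,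
      getElem?_pos, List.getElem_cons_zero, Option.map_eq_some_iff] at hcell
    obtain ⟨u, hu, hu0⟩ := hcell
    -- The sign of `u` is the same at `x₀` and along `l`, and `u` vanishes at `x₀`.
    have hzero : ∀ᶠ x in l, u x = 0 := by
      rcases (hτ 0 u hu).sign hx₀ hl₀' with h | h | h
      · exact (eventually_sup.1 h).2
      · exact absurd hu0 (eventually_pure.1 (eventually_sup.1 h).1).ne
      · exact absurd hu0 (eventually_pure.1 (eventually_sup.1 h).1).ne'
    obtain ⟨x, hx, hxB, hxu⟩ := (hy.and (h1.and hzero)).exists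
    obtain ⟨s', hs', hr'⟩ := hcomp (us.map fun u => u x)
    rw [Set.indicator_of_mem hxB, hs'.unique ⟨⟨n, hx⟩, hs⟩] at hr'
    have := hr' 0 (by simp)
    simp [FunTape.eval, hu, hxu] at this

/-! ### Unique decoding of programs -/

section Code

theorem ArithOp.code_injective : Function.Injective ArithOp.code := by
  intro a b h
  cases a <;> cases b <;> simp [ArithOp.code] at h ⊢

theorem Test.code_injective : Function.Injective Test.code := by
  intro a b h
  cases a <;> cases b <;> simp [Test.code] at h ⊢

theorem Instr.code_injective : Function.Injective Instr.code := by
  intro a b h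
  cases a <;> cases b <;> simp [Instr.code] at h ⊢
  all_goals simp_all [ArithOp.code_injective.eq_iff, Test.code_injective.eq_iff]

@[simp]
theorem Instr.length_code (I : Instr) : I.code.length = 5 := by
  cases I <;> rfl

/-- The leading entry gives the number of blocks, and all blocks have the same length. -/
theorem Program.code_append_inj {P Q : Program} {x y : Tuple}
    (h : P.code ++ x = Q.code ++ y) : P = Q ∧ x = y := by
  simp only [Program.code, List.cons_append, List.cons.injEq, Nat.cast_inj] at h
  obtain ⟨hlen, h⟩ := h
  induction P generalizing Q with
  | nil =>
    obtain rfl := List.length_eq_zero_iff.1 hlen.symm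
    exact ⟨rfl, h⟩
  | cons I P ih =>
    cases Q with
    | nil => simp at hlen
    | cons J Q =>
      simp only [List.flatMap_cons, List.append_assoc] at h
      obtain ⟨h1, h2⟩ := List.append_inj h (by simp)
      obtain ⟨rfl, rfl⟩ := ih (by simpa using hlen) h2
      exact ⟨by rw [Instr.code_injective h1], rfl⟩

theorem code_append_mem_haltingProblem {P : Program} {x : Tuple} :
    P.code ++ x ∈ haltingProblem ↔ P.Halts x := by
  constructor
  · rintro ⟨Q, y, h, hy⟩
    obtain ⟨rfl, rfl⟩ := Program.code_append_inj h
    exact hy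
  · exact fun h => ⟨P, x, rfl, h⟩

end Code

/-! ### The orbit problem for `a ↦ a ^ 2 - 2` -/

section Orbit

/-- The map `a ↦ a ^ 2 - 2`. -/
def sqSubTwo (a : ℝ) : ℝ := a * a - 2

/-- On input `(x, y)`, this program halts if and only if `y` is in the forward orbit of `x` under
the map `a ↦ a ^ 2 - 2`. -/
def orbitProgram : Program :=
  [.arith .sub 2 0 1, .fork .zero 2 6, .arith .mul 0 0 0, .const 3 2, .arith .sub 0 0 3,
    .fork .blank 4 0]

/-- One round takes six steps; cell 4 stays blank, which makes the last fork an unconditional jump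
back. -/
theorem orbitProgram_loop {w : Tuple} {m : ℕ} {t : Tape} {a y : ℝ}
    (h : OracleProgram.run ∅ (orbitProgram.map .basic) w m = some ⟨0, t⟩)
    (h0 : t 0 = some a) (h1 : t 1 = some y) (h4 : t 4 = none) (hay : a ≠ y) :
    ∃ t' : Tape, OracleProgram.run ∅ (orbitProgram.map .basic) w (m + 6) = some ⟨0, t'⟩ ∧
      t' 0 = some (sqSubTwo a) ∧ t' 1 = some y ∧ t' 4 = none := by
  simp only [OracleProgram.run, h, Option.bind_some, OracleProgram.step]
  simp [orbitProgram, OracleProgram.step, OracleInstr.step, Instr.step, h0, h1, h4,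
    ArithOp.eval, Test.Holds, sub_eq_zero, hay, sqSubTwo]

theorem orbitProgram_run {x y : ℝ} (n : ℕ) (h : ∀ k < n, sqSubTwo^[k] x ≠ y) :
    ∃ t : Tape, OracleProgram.run ∅ (orbitProgram.map .basic) [x, y] (6 * n) = some ⟨0, t⟩ ∧
      t 0 = some (sqSubTwo^[n] x) ∧ t 1 = some y ∧ t 4 = none := by
  induction n with
  | zero => exact ⟨_, rfl, by simp [inputTape]⟩
  | succ n ih =>
    obtain ⟨t, ht, h0, h1, h4⟩ := ih fun k hk => h k (hk.trans n.lt_succ_self)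
    rw [Function.iterate_succ_apply', mul_add]
    exact orbitProgram_loop ht h0 h1 h4 (h n n.lt_succ_self)

theorem orbitProgram_halts_iff {x y : ℝ} :
    orbitProgram.Halts [x, y] ↔ ∃ n, sqSubTwo^[n] x = y := by
  classical
  constructor
  · rintro ⟨s, ⟨m, hm⟩, hs⟩
    by_contra! hne
    -- An orbit that avoids `y` keeps the run alive at time `6 * (m + 1)`, past the supposed halting
    -- time `m`.
    obtain ⟨t, ht, -⟩ := orbitProgram_run (m + 1) fun k _ => hne k
    have := OracleProgram.run_add hm hs (5 * m + 5)
    rw [show m + (5 * m + 5) + 1 = 6 * (m + 1) by ring, ht] at this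
    cases this
  · intro h
    obtain ⟨t, ht, h0, h1, h4⟩ := orbitProgram_run (Nat.find h) fun k hk => Nat.find_min h hk
    rw [Nat.find_spec h] at h0
    -- Two more steps, the subtraction and the fork, lead to address 6, just past the program.
    refine ⟨⟨6, Function.update t 2 (some 0)⟩, ⟨6 * Nat.find h + 2, ?_⟩, rfl⟩
    simp only [OracleProgram.run, ht, Option.bind_some, OracleProgram.step]
    simp [orbitProgram, OracleProgram.step, OracleInstr.step, Instr.step, h0, h1, ArithOp.eval, Test.Holds]

/-- The `n`-th iterate of `X ^ 2 - 2`. -/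
noncomputable def orbitPoly (F : Type*) [Field F] : ℕ → F[X]
  | 0 => X
  | n + 1 => orbitPoly F n * orbitPoly F n - 2

theorem aeval_orbitPoly {F : Type*} [Field F] [Algebra F ℝ] (x : ℝ) (n : ℕ) :
    aeval x (orbitPoly F n) = sqSubTwo^[n] x := by
  induction n with
  | zero => simp [orbitPoly]
  | succ n ih =>
    rw [Function.iterate_succ_apply', orbitPoly, map_sub, map_mul, ih, map_ofNat, sqSubTwo]

theorem natDegree_orbitPoly (F : Type*) [Field F] (n : ℕ) :
    (orbitPoly F n).natDegree = 2 ^ n := by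
  induction n with
  | zero => simp [orbitPoly]
  | succ n ih =>
    have h : (orbitPoly F n * orbitPoly F n).natDegree = 2 ^ (n + 1) := by
      rw [← pow_two, natDegree_pow, ih]; ring
    have h2 : (2 : F[X]).natDegree = 0 := natDegree_ofNat 2
    rw [orbitPoly, natDegree_sub_eq_left_of_natDegree_lt, h]
    rw [h, h2]
    positivity

/-- The map `θ ↦ 2 cos θ` carries angle doubling to `a ↦ a ^ 2 - 2`. -/
theorem sqSubTwo_iterate_cos (θ : ℝ) (n : ℕ) :
    sqSubTwo^[n] (2 * Real.cos θ) = 2 * Real.cos (2 ^ n * θ) := by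
  induction n with
  | zero => simp
  | succ n ih =>
    rw [Function.iterate_succ_apply', ih, pow_succ', mul_assoc, Real.cos_two_mul, sqSubTwo]
    ring

/-- The preimages of `y` under the iterates of `a ↦ a ^ 2 - 2` are dense in `[-2, 2]`. -/
theorem exists_sqSubTwo_iterate_eq {x y : ℝ} (hx : |x| ≤ 2) (hy : |y| ≤ 2) (n : ℕ) :
    ∃ z, sqSubTwo^[n] z = y ∧ |z - x| ≤ 4 * Real.pi / 2 ^ n := by
  rw [abs_le] at hx hy
  have hx' : 2 * Real.cos (Real.arccos (x / 2)) = x := by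
    rw [Real.cos_arccos] <;> linarith
  have hy' : 2 * Real.cos (Real.arccos (y / 2)) = y := by
    rw [Real.cos_arccos] <;> linarith
  set α := Real.arccos (x / 2)
  set β := Real.arccos (y / 2)
  have hpi := Real.pi_pos
  -- Every angle `(β + 2πj) / 2 ^ n` leads to `y` after `n` doublings; this `j` puts it within `2π /
  -- 2 ^ n` of `α`.
  set j : ℤ := ⌊(2 ^ n * α - β) / (2 * Real.pi)⌋
  have h1 : j * (2 * Real.pi) ≤ 2 ^ n * α - β :=
    (le_div_iff₀ (by positivity)).1 (Int.floor_le _)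
  have h2 : 2 ^ n * α - β < (j + 1) * (2 * Real.pi) :=
    (div_lt_iff₀ (by positivity)).1 (Int.lt_floor_add_one _)
  have hpow : (0 : ℝ) < 2 ^ n := by positivity
  refine ⟨2 * Real.cos ((β + j * (2 * Real.pi)) / 2 ^ n), ?_, ?_⟩
  · rw [sqSubTwo_iterate_cos, mul_div_cancel₀ _ hpow.ne', Real.cos_add_int_mul_two_pi, hy']
  · have h3 : |(β + j * (2 * Real.pi)) / 2 ^ n - α| ≤ 2 * Real.pi / 2 ^ n := by
      rw [div_sub' hpow.ne', abs_div, abs_of_pos hpow]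
      gcongr
      rw [abs_le]
      constructor <;> linarith
    have h4 := Real.abs_cos_sub_cos_le ((β + j * (2 * Real.pi)) / 2 ^ n) α
    calc _ = 2 * |Real.cos ((β + j * (2 * Real.pi)) / 2 ^ n) - Real.cos α| := by
          conv_lhs => rw [← hx', ← mul_sub, abs_mul, abs_of_pos two_pos]
      _ ≤ 2 * (2 * Real.pi / 2 ^ n) := by linarith
      _ = _ := by ring

end Orbit

/-! ### Infinite transcendence degree and the contradiction -/

/-- Integers lie in every `L`, so the code contributes only constant germs to the input. -/
theorem orbitProgram_code_int : ∀ c ∈ orbitProgram.code, ∃ n : ℤ, c = n := by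
  intro c hc
  simp only [Program.code, orbitProgram, List.flatMap_cons, Instr.code, ArithOp.code, Test.code,
    List.flatMap_nil, List.append_nil, List.cons_append, List.nil_append, List.length_cons,
    List.length_nil, List.mem_cons, List.not_mem_nil, or_false] at hc
  have h : c = 0 ∨ c = 1 ∨ c = 2 ∨ c = 3 ∨ c = 4 ∨ c = 6 := by
    norm_num at hc
    tauto
  rcases h with h | h | h | h | h | h
  · exact ⟨0, by simp [h]⟩
  · exact ⟨1, by simp [h]⟩
  · exact ⟨2, by simp [h]⟩
  · exact ⟨3, by simp [h]⟩
  · exact ⟨4, by simp [h]⟩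
  · exact ⟨6, by simp [h]⟩

theorem OracleProgram.finite_params (M : OracleProgram) :
    {c | ∃ i, OracleInstr.basic (.const i c) ∈ M}.Finite := by
  let f : OracleInstr → ℝ := fun I => match I with
    | .basic (.const _ c) => c
    | _ => 0
  refine ((List.finite_toSet M).image f).subset ?_
  rintro c ⟨i, hi⟩
  exact ⟨_, hi, rfl⟩

/-- A finitely generated extension has finite transcendence degree, and finiteness is transitive in
towers. -/
theorem not_finTrdeg_adjoin {K A : Type*} [Field K] [Field A] [Algebra K A] (h : ¬ FinTrdeg K A)
    {S : Set A} (hS : S.Finite) : ¬ FinTrdeg (IntermediateField.adjoin K S) A := by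
  intro h'
  have : Algebra.EssFiniteType K (IntermediateField.adjoin K S) :=
    IntermediateField.essFiniteType_iff.2 (IntermediateField.fg_adjoin_of_finite hS)
  exact h (FinTrdeg.trans K (IntermediateField.adjoin K S) A)

/-- Inversion preserves transcendence and makes large numbers small; the bound 2 is the range of `2
cos`. -/
theorem exists_transcendental_abs_le {K : Type*} [Field K] [Algebra K ℝ] (h : ¬ FinTrdeg K ℝ) :
    ∃ a : ℝ, Transcendental K a ∧ |a| ≤ 2 := by
  have h' : ¬ Algebra.IsAlgebraic K ℝ := fun _ => h inferInstance
  rw [Algebra.isAlgebraic_def] at h'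
  push Not at h'
  obtain ⟨a, ha⟩ := h'
  rcases le_total |a| 1 with h1 | h1
  · exact ⟨a, ha, by linarith⟩
  · refine ⟨a⁻¹, fun h => ha (IsAlgebraic.inv_iff.1 h), ?_⟩
    rw [abs_inv]
    linarith [inv_le_one_of_one_le₀ h1]

/-- If the halting problem is reducible to `C`, and membership in `C` of tuples with an entry
outside `K` depends only on their length, then `ℝ` has finite transcendence degree over `K`. -/
theorem finTrdeg_of_reducible {K : Subfield ℝ} {C : Set Tuple}
    (hdet : DeterminedOutside (K : Set ℝ) C) (hC : Reducible haltingProblem C) :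
    FinTrdeg K ℝ := by
  by_contra hK
  obtain ⟨M, hM⟩ := hC
  set S : Set ℝ := {c | ∃ i, OracleInstr.basic (.const i c) ∈ M}
  let F := IntermediateField.adjoin K S
  have hF : ¬ FinTrdeg F ℝ := not_finTrdeg_adjoin hK M.finite_params
  obtain ⟨y, hy, hy2⟩ := exists_transcendental_abs_le hF
  let L := F⟮y⟯
  have hL : ¬ FinTrdeg L ℝ := not_finTrdeg_adjoin hF (Set.finite_singleton y)
  obtain ⟨x₀, hx₀, hx2⟩ := exists_transcendental_abs_le hL
  have hyL : algebraMap L ℝ (IntermediateField.AdjoinSimple.gen F y) = y :=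
    IntermediateField.AdjoinSimple.algebraMap_gen F y
  choose z hzy hzx using exists_sqSubTwo_iterate_eq hx2 hy2
  have hz : Tendsto z atTop (𝓝 x₀) := by
    rw [tendsto_iff_dist_tendsto_zero]
    refine squeeze_zero (fun _ => dist_nonneg) hzx ?_
    exact tendsto_const_nhds.div_atTop (tendsto_pow_atTop_atTop_of_one_lt one_lt_two)
  have hzF : ∀ n, Transcendental F (z n) := fun n =>
    (transcendental_aeval_iff.1 (by rwa [aeval_orbitPoly (F := F) (z n) n, hzy])).1
  have hgen : EventuallyGeneric L (map z atTop) := by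
    refine fun N => eventually_map.2 ((eventually_ge_atTop N).mono fun n hn p hp hpN h => ?_)
    have := natDegree_le_of_aeval_eq_zero (hzF n) (orbitPoly F n)
      ((aeval_orbitPoly (z n) n).trans (hzy n)) hp h
    rw [natDegree_orbitPoly] at this
    have := n.lt_two_pow_self
    omega
  have hdetF : DeterminedOutside (algebraMap F ℝ).range C := by
    intro n
    obtain ⟨b, hb⟩ := hdet n
    refine ⟨b, fun v hv => ?_⟩
    rintro ⟨r, hr, hrF⟩
    exact hb v hv ⟨r, hr, fun hrK => hrF ⟨algebraMap K F ⟨r, hrK⟩, rfl⟩⟩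
  have hparam : ∀ i c, .basic (.const i c) ∈ M → c ∈ (algebraMap L ℝ).range := fun i c hc =>
    ⟨algebraMap F L ⟨c, IntermediateField.subset_adjoin K S ⟨i, hc⟩⟩, rfl⟩
  have hne : ∀ n, sqSubTwo^[n] x₀ ≠ y := by
    intro n h
    -- If `y` were in the orbit of `x₀`, this polynomial over `L` would make `x₀` algebraic.
    refine hx₀ ⟨orbitPoly L n - Polynomial.C (IntermediateField.AdjoinSimple.gen F y), ?_, ?_⟩
    · intro h0
      have := congrArg natDegree (sub_eq_zero.1 h0)
      rw [natDegree_orbitPoly, natDegree_C] at this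
      exact absurd this (by positivity)
    · rw [map_sub, aeval_orbitPoly, aeval_C, h, hyL, sub_self]
  let us : List (ℝ → ℝ) := orbitProgram.code.map (fun c _ => c) ++ [fun x => x, fun _ => y]
  have hus : ∀ x, (us.map fun u => u x) = orbitProgram.code ++ [x, y] := fun x => by
    simp [us, Function.comp_def]
  refine not_computes_of_frequently (us := us) hx₀ hz hgen hdetF hparam ?_ ?_ ?_ hM
  · intro u hu l
    simp only [us, List.mem_append, List.mem_map, List.mem_cons, List.not_mem_nil,
      or_false] at hu
    rcases hu with ⟨c, hc, rfl⟩ | rfl | rfl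
    · obtain ⟨n, rfl⟩ := orbitProgram_code_int c hc
      simpa using RationalGerm.const (l := l) (n : L)
    · exact RationalGerm.id
    · have := RationalGerm.const (L := L) (l := l) (IntermediateField.AdjoinSimple.gen F y)
      rwa [hyL] at this
  · rw [hus, code_append_mem_haltingProblem, orbitProgram_halts_iff]
    exact fun ⟨n, hn⟩ => hne n hn
  · refine eventually_map.2 (Eventually.of_forall fun n => ?_)
    rw [hus, code_append_mem_haltingProblem, orbitProgram_halts_iff]
    exact ⟨n, hzy n⟩

theorem notMem_of_notMem_coordField {D : Set Tuple} {v : Tuple}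
    (h : ∃ r ∈ v, r ∉ (coordField D : Set ℝ)) : v ∉ D := by
  obtain ⟨r, hr, hrD⟩ := h
  exact fun hv => hrD (Subfield.subset_closure ⟨v, hv, hr⟩)

end BSS

theorem corollary3p2 (C : Set BSS.Tuple) (hC : BSS.Reducible BSS.haltingProblem C) :
    Algebra.trdeg (BSS.coordField C) ℝ < Cardinal.aleph0 ∧
    Algebra.trdeg (BSS.coordField Cᶜ) ℝ < Cardinal.aleph0 ∧
    ∀ m : ℕ, (∀ v ∈ C, v.length = m) →
      Algebra.trdeg (BSS.coordField ({v | v.length = m} \ C)) ℝ < Cardinal.aleph0 := by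
  -- A tuple of length `n` with an entry outside the respective field is never in `C`, always in
  -- `C`, or in `C` exactly when `n = m`.
  refine ⟨finTrdeg_iff_trdeg.1 (BSS.finTrdeg_of_reducible (fun n => ⟨False, ?_⟩) hC),
    finTrdeg_iff_trdeg.1 (BSS.finTrdeg_of_reducible (fun n => ⟨True, ?_⟩) hC),
    fun m hm => finTrdeg_iff_trdeg.1 (BSS.finTrdeg_of_reducible (fun n => ⟨n = m, ?_⟩) hC)⟩
  · exact fun v _ h => iff_false_intro (BSS.notMem_of_notMem_coordField h)
  · exact fun v _ h => iff_true_intro (not_not.1 (BSS.notMem_of_notMem_coordField h))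
  · rintro v rfl h
    exact ⟨hm v, fun hv => by_contra fun hvC => BSS.notMem_of_notMem_coordField h ⟨hv, hvC⟩⟩
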